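/- **Proposition 4.4.** All algebras are unital and associative. Let $k$ be a field and let $n\ge 1$. Let $\mathrm{Alg}_n$ be the affine $k$-scheme of structure constants $(c^{i,j}_l)$ of associative algebras with basis $e_1,\dots,e_n$ and unit $e_1$. Let $\mathfrak{Alg}_n$ be the moduli stack over $k$ of $n$-dimensional algebras, that is, the quotient of $\mathrm{Alg}_n$ by the group of changes of basis fixing $e_1$; its points are the $n$-dimensional algebras over field extensions of $k$, two of them being identified if they become isomorphic over a common extension of their fields of definition, and its set of points has the quotient topology from $\mathrm{Alg}_n$. An $n$-dimensional algebra $A$ over a field $K$ has degree of algebraicity $\le d$ if the morphism $A\to\wedge^{d+1}A$, $a\mapsto 1\wedge a\wedge a^2\wedge\dots\wedge a^d$, is the zero morphism of $K$-schemes, i.e. is zero after every base change to a commutative $K$-algebra. Let $\mathfrak{Alg}_{n,\le d}\subset\mathfrak{Alg}_n$ and $\mathrm{Alg}_{n,\le d}\subset\mathrm{Alg}_n$ be the closed loci of algebras of degree of algebraicity $\le d$. Let $n_1,\dots,n_r\ge 1$ be integers, at least one of which is $\ge 2$, let $n=n_1^2+\dots+n_r^2$, and let $\nu=\min_i n_i$.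 Then every irreducible component of $\mathfrak{Alg}_n$ that contains the point of the algebra $\mathscr A_0=M_{n_1}(k)\times\dots\times M_{n_r}(k)$ is contained in $\mathfrak{Alg}_{n,\le n-\nu}$. Likewise, every irreducible component of $\mathrm{Alg}_n$ that contains a point lying over the point of $\mathscr A_0$ is contained in $\mathrm{Alg}_{n,\le n-\nu}$. -/

import Mathlib

open scoped TensorProduct

universe u v

/-- A unital associative multiplication on the free `R`-module with basis `e_0, …, e_{n-1}` whose
unit is `e_0`, given by its structure constants `e_i e_j = ∑ l, c i j l • e_l`. -/
structure MulTable (n : ℕ) [NeZero n] (R : Type u) [CommRing R] where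
  c : Fin n → Fin n → Fin n → R
  one_left : ∀ j l, c 0 j l = if j = l then 1 else 0
  one_right : ∀ i l, c i 0 l = if i = l then 1 else 0
  assoc : ∀ i j m p, ∑ l, c i j l * c l m p = ∑ l, c j m l * c i l p

namespace MulTable

variable {n : ℕ} [NeZero n] {R : Type u} [CommRing R]

/-- Base change of a multiplication table along a ring homomorphism. -/
def map {S : Type v} [CommRing S] (t : MulTable n R) (f : R →+* S) : MulTable n S where
  c i j l := f (t.c i j l)
  one_left j l := by rw [t.one_left]; split_ifs <;> simp
  one_right i l := by rw [t.one_right]; split_ifs <;> simp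
  assoc i j m p := by
    have h := congrArg f (t.assoc i j m p)
    simpa only [map_sum, map_mul] using h

/-- The algebra with a given multiplication table: the module `R ^ n` with the multiplication
`(a b)_l = ∑ i j, a_i b_j c i j l`. -/
def Carrier (_t : MulTable n R) : Type u := Fin n → R

namespace Carrier

variable (t : MulTable n R)

instance : AddCommGroup t.Carrier := inferInstanceAs (AddCommGroup (Fin n → R))

instance : Module R t.Carrier := inferInstanceAs (Module R (Fin n → R))

instance : Mul t.Carrier := ⟨fun a b l => ∑ i, ∑ j, a i * b j * t.c i j l⟩

instance : One t.Carrier := ⟨fun l => if 0 = l then 1 else 0⟩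

theorem mul_apply (a b : t.Carrier) (l : Fin n) :
    (a * b) l = ∑ i, ∑ j, a i * b j * t.c i j l := rfl

theorem one_apply (l : Fin n) : (1 : t.Carrier) l = if 0 = l then 1 else 0 := rfl

theorem add_apply (a b : t.Carrier) (l : Fin n) : (a + b) l = a l + b l := rfl

theorem zero_apply (l : Fin n) : (0 : t.Carrier) l = 0 := rfl

theorem smul_apply (s : R) (a : t.Carrier) (l : Fin n) : (s • a) l = s * a l := rfl

theorem mul_assoc' (a b d : t.Carrier) : a * b * d = a * (b * d) := by
  funext p
  simp only [mul_apply, Finset.sum_mul, Finset.mul_sum]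
  have h : ∀ i j m : Fin n,
      (∑ l, a i * b j * t.c i j l * d m * t.c l m p) =
        ∑ l, a i * (b j * d m * t.c j m l) * t.c i l p := by
    intro i j m
    have h1 := congrArg (fun z => a i * b j * d m * z) (t.assoc i j m p)
    simp only [Finset.mul_sum] at h1
    calc _ = ∑ l, a i * b j * d m * (t.c i j l * t.c l m p) :=
          Finset.sum_congr rfl fun l _ => by ring
      _ = _ := h1
      _ = _ := Finset.sum_congr rfl fun l _ => by ring
  calc (∑ l, ∑ m, ∑ i, ∑ j, a i * b j * t.c i j l * d m * t.c l m p)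
      = ∑ m, ∑ l, ∑ i, ∑ j, a i * b j * t.c i j l * d m * t.c l m p := Finset.sum_comm
    _ = ∑ m, ∑ i, ∑ l, ∑ j, a i * b j * t.c i j l * d m * t.c l m p :=
        Finset.sum_congr rfl fun m _ => Finset.sum_comm
    _ = ∑ i, ∑ m, ∑ l, ∑ j, a i * b j * t.c i j l * d m * t.c l m p := Finset.sum_comm
    _ = ∑ i, ∑ m, ∑ j, ∑ l, a i * b j * t.c i j l * d m * t.c l m p :=
        Finset.sum_congr rfl fun i _ => Finset.sum_congr rfl fun m _ => Finset.sum_comm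
    _ = ∑ i, ∑ m, ∑ j, ∑ l, a i * (b j * d m * t.c j m l) * t.c i l p := by
        simp only [h]
    _ = ∑ i, ∑ m, ∑ l, ∑ j, a i * (b j * d m * t.c j m l) * t.c i l p :=
        Finset.sum_congr rfl fun i _ => Finset.sum_congr rfl fun m _ => Finset.sum_comm
    _ = ∑ i, ∑ l, ∑ m, ∑ j, a i * (b j * d m * t.c j m l) * t.c i l p :=
        Finset.sum_congr rfl fun i _ => Finset.sum_comm
    _ = ∑ i, ∑ l, ∑ j, ∑ m, a i * (b j * d m * t.c j m l) * t.c i l p :=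
        Finset.sum_congr rfl fun i _ => Finset.sum_congr rfl fun l _ => Finset.sum_comm

theorem one_mul' (a : t.Carrier) : 1 * a = a := by
  have h : ∀ (b : Fin n → R) (l : Fin n), (∑ i, ∑ j, (if 0 = i then 1 else 0) * b j * t.c i j l)
      = b l := by
    intro b l
    simp [t.one_left]
  exact funext fun l => h a l

theorem mul_one' (a : t.Carrier) : a * 1 = a := by
  have h : ∀ (b : Fin n → R) (l : Fin n), (∑ i, ∑ j, b i * (if 0 = j then 1 else 0) * t.c i j l)
      = b l := by
    intro b l
    simp [t.one_right]
  exact funext fun l => h a l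

instance : Ring t.Carrier :=
  { (inferInstance : AddCommGroup t.Carrier), (inferInstance : Mul t.Carrier),
    (inferInstance : One t.Carrier) with
    mul_assoc := mul_assoc' t
    one_mul := one_mul' t
    mul_one := mul_one' t
    left_distrib := fun a b d => by
      funext l
      simp only [mul_apply, add_apply, mul_add, add_mul, Finset.sum_add_distrib]
    right_distrib := fun a b d => by
      funext l
      simp only [mul_apply, add_apply, add_mul, Finset.sum_add_distrib]
    zero_mul := fun a => by
      funext l
      simp [mul_apply, zero_apply]
    mul_zero := fun a => by
      funext l
      simp [mul_apply, zero_apply] }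

instance : Algebra R t.Carrier :=
  Algebra.ofModule
    (fun s a b => by
      funext l
      simp only [mul_apply, smul_apply, Finset.mul_sum, mul_assoc])
    (fun s a b => by
      funext l
      simp only [mul_apply, smul_apply, Finset.mul_sum]
      exact Finset.sum_congr rfl fun i _ => Finset.sum_congr rfl fun j _ => by ring)

theorem finrank_eq [Nontrivial R] : Module.finrank R t.Carrier = n := by
  have h : Module.finrank R (Fin n → R) = n := Module.finrank_fin_fun R
  exact h

end Carrier

end MulTable

section AlgScheme

variable (k : Type u) [Field k] (n : ℕ) [NeZero n]

/-- The coordinates of the affine space of dimension `n (n-1)^2` containing `Alg_n`. -/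
abbrev AlgVar : Type := {i : Fin n // i ≠ 0} × {j : Fin n // j ≠ 0} × Fin n

/-- The generic structure constants: `e_0` is the unit, and the remaining ones are free. -/
noncomputable def genConst (i j l : Fin n) : MvPolynomial (AlgVar n) k :=
  if hi : i = 0 then (if j = l then 1 else 0)
  else if hj : j = 0 then (if i = l then 1 else 0)
  else MvPolynomial.X (⟨i, hi⟩, ⟨j, hj⟩, l)

/-- The ideal of the associativity relations `(e_i e_j) e_m = e_i (e_j e_m)`. -/
noncomputable def assocIdeal : Ideal (MvPolynomial (AlgVar n) k) :=
  Ideal.span (Set.range fun q : Fin n × Fin n × Fin n × Fin n =>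
    ∑ l, genConst k n q.1 q.2.1 l * genConst k n l q.2.2.1 q.2.2.2 -
      ∑ l, genConst k n q.2.1 q.2.2.1 l * genConst k n q.1 l q.2.2.2)

/-- The coordinate ring of the affine `k`-scheme `Alg_n`. -/
abbrev AlgRing : Type u := MvPolynomial (AlgVar n) k ⧸ assocIdeal k n

/-- The scheme `Alg_n` over `k`, as a topological space. -/
abbrev AlgSpace : Type u := PrimeSpectrum (AlgRing k n)

/-- The universal multiplication table over `Alg_n`. -/
noncomputable def univTable : MulTable n (AlgRing k n) where
  c i j l := Ideal.Quotient.mk (assocIdeal k n) (genConst k n i j l)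
  one_left j l := by
    simp only [genConst, dite_true]
    split_ifs <;> simp
  one_right i l := by
    by_cases hi : i = 0
    · subst hi
      simp only [genConst, dite_true]
      split_ifs <;> simp
    · simp only [genConst, hi, dite_false, dite_true]
      split_ifs <;> simp
  assoc i j m p := by
    have h : (∑ l, genConst k n i j l * genConst k n l m p -
        ∑ l, genConst k n j m l * genConst k n i l p) ∈ assocIdeal k n :=
      Ideal.subset_span ⟨(i, j, m, p), rfl⟩
    have h2 := Ideal.Quotient.eq.mpr h
    simpa only [map_sum, map_mul] using h2

/-- The multiplication table over the residue field of a point `x` of `Alg_n`: its algebra is the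
fibre at `x` of the universal algebra. -/
noncomputable def tableAt (x : AlgSpace k n) : MulTable n x.asIdeal.ResidueField :=
  (univTable k n).map (algebraMap (AlgRing k n) x.asIdeal.ResidueField)

end AlgScheme

/-- The degree of algebraicity of the `R`-algebra `A` is at most `d`: the morphism of functors on
commutative `R`-algebras `A → ⋀^{d+1} A`, `a ↦ 1 ∧ a ∧ a² ∧ ⋯ ∧ a^d`, is zero. -/
def DegLE (R A : Type u) [CommRing R] [Ring A] [Algebra R A] (d : ℕ) : Prop :=
  ∀ (S : Type u) [CommRing S] [Algebra R S] (a : S ⊗[R] A),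
    exteriorPower.ιMulti S (d + 1) (fun i : Fin (d + 1) => a ^ (i : ℕ)) = 0

/-- An object of the moduli stack of `n`-dimensional algebras over a field extension of `k`. -/
structure AlgObj (k : Type u) [Field k] (n : ℕ) where
  K : Type u
  [fieldK : Field K]
  [algK : Algebra k K]
  A : Type u
  [ringA : Ring A]
  [algA : Algebra K A]
  finrank_eq : Module.finrank K A = n

attribute [instance] AlgObj.fieldK AlgObj.algK AlgObj.ringA AlgObj.algA

/-- Two field-valued objects of the stack represent the same point when they become isomorphic over
a common extension of their fields of definition. -/
def AlgObj.SamePoint {k : Type u} [Field k] {n : ℕ} (P Q : AlgObj k n) : Prop :=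
  ∃ (L : Type u) (_ : Field L) (_ : Algebra P.K L) (_ : Algebra Q.K L),
    (algebraMap P.K L).comp (algebraMap k P.K) = (algebraMap Q.K L).comp (algebraMap k Q.K) ∧
    Nonempty ((L ⊗[P.K] P.A) ≃ₐ[L] (L ⊗[Q.K] Q.A))

/-- The underlying set of points of the moduli stack of `n`-dimensional algebras over `k`: the
field-valued objects up to the equivalence relation `AlgObj.SamePoint`. -/
def AlgStack (k : Type u) [Field k] (n : ℕ) : Type (u + 1) :=
  Quot (AlgObj.SamePoint (k := k) (n := n))

namespace AlgStack

variable {k : Type u} [Field k] {n : ℕ}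

/-- The point of the stack represented by a field-valued object. -/
def pt (P : AlgObj k n) : AlgStack k n := Quot.mk _ P

/-- The points of the closed substack of algebras of degree of algebraicity at most `d`. -/
def degLE (k : Type u) [Field k] (n d : ℕ) : Set (AlgStack k n) :=
  pt '' {P : AlgObj k n | DegLE P.K P.A d}

variable [NeZero n]

/-- The object given by the fibre of the universal algebra at a point of `Alg_n`. -/
noncomputable def objAt (x : AlgSpace k n) : AlgObj k n where
  K := x.asIdeal.ResidueField
  A := (tableAt k n x).Carrier
  finrank_eq := MulTable.Carrier.finrank_eq _

/-- The map on points of the presentation of the stack as the quotient of `Alg_n` by the group of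
changes of basis. -/
noncomputable def proj (x : AlgSpace k n) : AlgStack k n := pt (objAt x)

/-- The topology of the stack: the quotient topology for its presentation by `Alg_n`. -/
noncomputable instance : TopologicalSpace (AlgStack k n) := TopologicalSpace.coinduced proj inferInstance

end AlgStack

/-- The points of the closed subscheme of `Alg_n` where the degree of algebraicity is at most `d`. -/
def AlgSpace.degLE (k : Type u) [Field k] (n : ℕ) [NeZero n] (d : ℕ) : Set (AlgSpace k n) :=
  {x | DegLE x.asIdeal.ResidueField (tableAt k n x).Carrier d}

/-- The algebra `M_{m_1}(k) × ⋯ × M_{m_r}(k)`, as an object of the stack over `k` itself. -/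
def matrixProductObj (k : Type u) [Field k] {r : ℕ} (m : Fin r → ℕ) {n : ℕ}
    (hn : n = ∑ i, m i ^ 2) : AlgObj k n where
  K := k
  A := ∀ i : Fin r, Matrix (Fin (m i)) (Fin (m i)) k
  finrank_eq := by
    rw [Module.finrank_pi_fintype, hn]
    simp [Module.finrank_matrix, sq]

/-! ### Vanishing in exterior powers by minors. -/

section Minors

variable {S : Type u} [CommRing S] {M : Type v} [AddCommGroup M] [Module S M]

/-! The point of `𝒜₀ = ∏ M_{n_i}(k)` is open in the stack and lies in the closed degree locus. An
irreducible set containing it has it as a dense open subset, hence lies in that locus. The same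
argument with preimages handles `Alg_n`.

Degree: by Cayley–Hamilton, an element of `∏ M_{n_i}` is killed by the product of its characteristic
polynomials, monic of degree `∑ n_i`. Since some `n_j ≥ 2`, `∑ n_i ≤ n - ν` (`MatrixProduct.degLE`,
`sum_le_sum_sq_sub_of_isLeast`).

Closedness: the coordinates of `1 ∧ a ∧ ⋯ ∧ a^d` for the generic element `a` are polynomials whose
coefficients are functions of the structure constants, and the degree is `≤ d` exactly when all of
them vanish (`degLE_iff_genMinor`, `AlgSpace.isClosed_degLE`).

Openness: `𝒜₀` is separable, so homomorphisms out of it lift along square-zero extensions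
(`IsSeparableAlgebra.exists_lift`). Hence the scheme of homomorphisms from `𝒜₀` to the universal
algebra is smooth over `Alg_n` (`HomRing.smooth`). Smooth morphisms are open, so the image of the
open subscheme of isomorphisms is open (`isOpen_isomLocus`). This image is the preimage of the point
of `𝒜₀`. -/

theorem exteriorPower.ιMulti_eq_zero_iff_det {I : Type*} [LinearOrder I]
    (b : Module.Basis I S M) {d : ℕ} (v : Fin d → M) :
    exteriorPower.ιMulti S d v = 0 ↔
      ∀ s : Fin d ↪o I, (Matrix.of fun i j => b.repr (v i) (s j)).det = 0 := by
  rw [(b.exteriorPower d).ext_elem_iff, ← Set.powersetCard.ofFinEmbEquiv.symm.forall_congr_right]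
  simp [exteriorPower.basis_repr_apply]

end Minors

/-! ### Structure constants and the generic element. -/

section StructureConstants

variable {R : Type u} [CommRing R] {n : ℕ}

theorem Module.Basis.repr_mul_eq_sum {A : Type v} [Ring A] [Algebra R A] {ι : Type*} [Fintype ι]
    (b : Module.Basis ι R A) (x y : A) (l : ι) :
    b.repr (x * y) l = ∑ j, ∑ k, b.repr x j * b.repr y k * b.repr (b j * b k) l := by
  have h : x * y = ∑ j, ∑ k, (b.repr x j * b.repr y k) • (b j * b k) := by
    conv_lhs => rw [← b.sum_repr x, ← b.sum_repr y]
    simp only [Finset.sum_mul, Finset.mul_sum, smul_mul_smul_comm]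
    exact Finset.sum_comm
  rw [h]
  simp

/-- Algebras having bases with the same structure constants are isomorphic. -/
noncomputable def Module.Basis.algEquivOfReprEq {A B : Type*} [Ring A] [Algebra R A] [Ring B]
    [Algebra R B] {ι : Type*} [Fintype ι] (b : Module.Basis ι R A) (b' : Module.Basis ι R B)
    (h1 : ∀ l, b.repr 1 l = b'.repr 1 l)
    (hmul : ∀ i j l, b.repr (b i * b j) l = b'.repr (b' i * b' j) l) : A ≃ₐ[R] B :=
  have hr (a : A) : b'.repr (b.equiv b' (Equiv.refl ι) a) = b.repr a := by
    simp [Module.Basis.equiv]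
  AlgEquiv.ofLinearEquiv (b.equiv b' (Equiv.refl ι))
    (b'.ext_elem fun l => by rw [hr, h1])
    (fun x y => b'.ext_elem fun l => by
      rw [hr, b.repr_mul_eq_sum, b'.repr_mul_eq_sum]
      simp only [hr, hmul])

/-- The coordinates of the powers of the generic element of an algebra, in terms of the coordinates
`e` of its unit and of its structure constants `c`. -/
noncomputable def genPowCoord (e : Fin n → R) (c : Fin n → Fin n → Fin n → R) :
    ℕ → Fin n → MvPolynomial (Fin n) R
  | 0 => fun l => MvPolynomial.C (e l)
  | i + 1 => fun l =>
      ∑ j, ∑ k, genPowCoord e c i j * MvPolynomial.X k * MvPolynomial.C (c j k l)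

/-- The coordinates of `1 ∧ a ∧ ⋯ ∧ a ^ d` for the generic element `a` of an algebra. -/
noncomputable def genMinor (e : Fin n → R) (c : Fin n → Fin n → Fin n → R) (d : ℕ)
    (s : Fin (d + 1) ↪o Fin n) : MvPolynomial (Fin n) R :=
  (Matrix.of fun i j : Fin (d + 1) => genPowCoord e c i (s j)).det

theorem map_genPowCoord {S : Type*} [CommRing S] (φ : R →+* S) (e : Fin n → R)
    (c : Fin n → Fin n → Fin n → R) (i : ℕ) (l : Fin n) :
    MvPolynomial.map φ (genPowCoord e c i l) =
      genPowCoord (fun j => φ (e j)) (fun j k l => φ (c j k l)) i l := by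
  induction i generalizing l with
  | zero => simp [genPowCoord]
  | succ i ih => simp [genPowCoord, ih]

theorem map_genMinor {S : Type*} [CommRing S] (φ : R →+* S) (e : Fin n → R)
    (c : Fin n → Fin n → Fin n → R) (d : ℕ) (s : Fin (d + 1) ↪o Fin n) :
    MvPolynomial.map φ (genMinor e c d s) =
      genMinor (fun j => φ (e j)) (fun j k l => φ (c j k l)) d s := by
  rw [genMinor, RingHom.map_det]
  congr 1
  ext1 i j
  simp [map_genPowCoord]

theorem Module.Basis.repr_pow_eq_eval {A : Type v} [Ring A] [Algebra R A]
    (b : Module.Basis (Fin n) R A) (a : A) (i : ℕ) (l : Fin n) :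
    b.repr (a ^ i) l = MvPolynomial.eval (b.repr a)
      (genPowCoord (b.repr 1) (fun j k => b.repr (b j * b k)) i l) := by
  induction i generalizing l with
  | zero => simp [genPowCoord]
  | succ i ih =>
    rw [pow_succ, b.repr_mul_eq_sum]
    simp [genPowCoord, ih]

theorem Module.Basis.ιMulti_pow_eq_zero_iff {A : Type v} [Ring A] [Algebra R A]
    (b : Module.Basis (Fin n) R A) (a : A) (d : ℕ) :
    exteriorPower.ιMulti R (d + 1) (fun i : Fin (d + 1) => a ^ (i : ℕ)) = 0 ↔
      ∀ s, MvPolynomial.eval (b.repr a)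
        (genMinor (b.repr 1) (fun j k => b.repr (b j * b k)) d s) = 0 := by
  rw [exteriorPower.ιMulti_eq_zero_iff_det b]
  refine forall_congr' fun s => ?_
  rw [genMinor, RingHom.map_det]
  simp only [b.repr_pow_eq_eval]
  rfl

theorem Module.Basis.baseChange_repr_one_tmul {A : Type v} [Ring A] [Algebra R A] (S : Type*)
    [CommRing S] [Algebra R S] {ι : Type*} (b : Module.Basis ι R A) (x : A) (l : ι) :
    (b.baseChange S).repr ((1 : S) ⊗ₜ[R] x) l = algebraMap R S (b.repr x l) := by
  rw [Module.Basis.baseChange_repr_tmul, Algebra.algebraMap_eq_smul_one]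

theorem genMinor_baseChange {A : Type v} [Ring A] [Algebra R A] (S : Type*)
    [CommRing S] [Algebra R S] (b : Module.Basis (Fin n) R A) (d : ℕ)
    (s : Fin (d + 1) ↪o Fin n) :
    genMinor ((b.baseChange S).repr 1)
        (fun j k => (b.baseChange S).repr (b.baseChange S j * b.baseChange S k)) d s =
      MvPolynomial.map (algebraMap R S)
        (genMinor (b.repr 1) (fun j k => b.repr (b j * b k)) d s) := by
  rw [map_genMinor]
  congr 1
  · funext j
    rw [Algebra.TensorProduct.one_def, Module.Basis.baseChange_repr_one_tmul]
  · funext j k l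
    simp only [Module.Basis.baseChange_apply, Algebra.TensorProduct.tmul_mul_tmul, one_mul,
      Module.Basis.baseChange_repr_one_tmul]

end StructureConstants

/-! ### The degree of algebraicity through generic minors. -/

section DegLE

variable {R : Type u} [CommRing R] {n : ℕ}

theorem degLE_iff_genMinor {A : Type u} [Ring A] [Algebra R A] (b : Module.Basis (Fin n) R A)
    (d : ℕ) :
    DegLE R A d ↔ ∀ s, genMinor (b.repr 1) (fun j k => b.repr (b j * b k)) d s = 0 := by
  constructor
  · intro h s
    -- Test on the generic element, whose coordinates are the variables: evaluating a minor there
    -- returns the minor itself as a polynomial.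
    set S := MvPolynomial (Fin n) R
    have h1 := h S ((b.baseChange S).equivFun.symm MvPolynomial.X)
    rw [(b.baseChange S).ιMulti_pow_eq_zero_iff] at h1
    have h2 := h1 s
    rw [genMinor_baseChange, MvPolynomial.eval_map] at h2
    have h3 : ((b.baseChange S).repr ((b.baseChange S).equivFun.symm MvPolynomial.X) : Fin n → S)
        = MvPolynomial.X := (b.baseChange S).equivFun.apply_symm_apply _
    rw [h3, MvPolynomial.algebraMap_eq, MvPolynomial.eval₂_eta] at h2
    exact h2
  · intro h S _ _ a
    rw [(b.baseChange S).ιMulti_pow_eq_zero_iff]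
    intro s
    rw [genMinor_baseChange, h s, map_zero, map_zero]

theorem DegLE.of_algEquiv {A B : Type u} [Ring A] [Algebra R A] [Ring B] [Algebra R B] {d : ℕ}
    (e : A ≃ₐ[R] B) (h : DegLE R A d) : DegLE R B d := by
  intro S _ _ a
  let f : S ⊗[R] A ≃ₐ[S] S ⊗[R] B := Algebra.TensorProduct.congr AlgEquiv.refl e
  have h1 := congrArg (exteriorPower.map (d + 1) f.toLinearMap) (h S (f.symm a))
  rw [exteriorPower.map_apply_ιMulti, map_zero] at h1
  rw [← h1]
  congr 1
  funext i
  simp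

/-- Generic minors commute with base change, and a field extension is injective on their
coefficients. This makes the degree condition well defined on points of the stack. -/
theorem degLE_baseChange_iff {K : Type u} [Field K] {A : Type u} [Ring A] [Algebra K A]
    (b : Module.Basis (Fin n) K A) (L : Type u) [Field L] [Algebra K L] (d : ℕ) :
    DegLE L (L ⊗[K] A) d ↔ DegLE K A d := by
  rw [degLE_iff_genMinor b, degLE_iff_genMinor (b.baseChange L)]
  refine forall_congr' fun s => ?_
  rw [genMinor_baseChange]
  exact map_eq_zero_iff _ (MvPolynomial.map_injective _ (algebraMap K L).injective)

theorem AlgObj.SamePoint.degLE_iff {k : Type u} [Field k] [NeZero n] {P Q : AlgObj k n}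
    (h : P.SamePoint Q) (d : ℕ) : DegLE P.K P.A d ↔ DegLE Q.K Q.A d := by
  obtain ⟨L, _, _, _, -, ⟨e⟩⟩ := h
  have hP : Module.Finite P.K P.A :=
    Module.finite_of_finrank_pos (by rw [P.finrank_eq]; exact Nat.pos_of_neZero n)
  have hQ : Module.Finite Q.K Q.A :=
    Module.finite_of_finrank_pos (by rw [Q.finrank_eq]; exact Nat.pos_of_neZero n)
  rw [← degLE_baseChange_iff (Module.finBasisOfFinrankEq _ _ P.finrank_eq) L,
    ← degLE_baseChange_iff (Module.finBasisOfFinrankEq _ _ Q.finrank_eq) L]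
  exact ⟨DegLE.of_algEquiv e, DegLE.of_algEquiv e.symm⟩

theorem AlgStack.pt_mem_degLE_iff {k : Type u} [Field k] [NeZero n] (P : AlgObj k n) (d : ℕ) :
    AlgStack.pt P ∈ AlgStack.degLE k n d ↔ DegLE P.K P.A d := by
  constructor
  · rintro ⟨Q, hQ, h⟩
    -- Equality in the quotient only gives a chain of `SamePoint` relations, along which the
    -- invariant is carried.
    have h1 : Relation.EqvGen AlgObj.SamePoint Q P := Quot.eqvGen_exact h
    have h2 : DegLE Q.K Q.A d ↔ DegLE P.K P.A d := by
      clear hQ h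
      induction h1 with
      | rel _ _ h => exact h.degLE_iff d
      | refl => rfl
      | symm _ _ _ ih => exact ih.symm
      | trans _ _ _ _ _ ih1 ih2 => exact ih1.trans ih2
    exact h2.1 hQ
  · exact fun h => ⟨P, h, rfl⟩

end DegLE

/-! ### The degree locus is closed. -/

namespace MulTable

variable {n : ℕ} [NeZero n] {R : Type u} [CommRing R]

/-- The standard basis of the algebra of a multiplication table. -/
noncomputable def basis (t : MulTable n R) : Module.Basis (Fin n) R t.Carrier :=
  Module.Basis.ofEquivFun (LinearEquiv.refl R (Fin n → R) : t.Carrier ≃ₗ[R] (Fin n → R))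

theorem basis_repr (t : MulTable n R) (a : t.Carrier) (l : Fin n) : t.basis.repr a l = a l := rfl

theorem basis_repr_one (t : MulTable n R) (l : Fin n) :
    t.basis.repr 1 l = if 0 = l then 1 else 0 := rfl

theorem basis_repr_mul_basis (t : MulTable n R) (i j l : Fin n) :
    t.basis.repr (t.basis i * t.basis j) l = t.c i j l := by
  have h (i j : Fin n) : t.basis i j = if i = j then 1 else 0 := by
    have h1 := t.basis_repr (t.basis i) j
    rw [t.basis.repr_self, Finsupp.single_apply] at h1
    exact h1.symm
  refine (Carrier.mul_apply t _ _ l).trans ?_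
  simp only [h]
  simp

/-- The algebra of a base-changed multiplication table is the base change of the algebra. -/
noncomputable def baseChangeEquiv (t : MulTable n R) (S : Type v) [CommRing S] [Algebra R S] :
    S ⊗[R] t.Carrier ≃ₐ[S] (t.map (algebraMap R S)).Carrier :=
  (t.basis.baseChange S).algEquivOfReprEq (t.map (algebraMap R S)).basis
    (fun l => by
      rw [Algebra.TensorProduct.one_def, Module.Basis.baseChange_repr_one_tmul, basis_repr_one,
        basis_repr_one]
      split_ifs <;> simp)
    (fun i j l => by
      simp only [Module.Basis.baseChange_apply, Algebra.TensorProduct.tmul_mul_tmul, one_mul,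
        Module.Basis.baseChange_repr_one_tmul, basis_repr_mul_basis]
      rfl)

end MulTable

/-- The locus is cut out by the coefficients of the generic minors of the universal algebra, since
these specialise to the generic minors of each fibre. -/
theorem AlgSpace.isClosed_degLE (k : Type u) [Field k] (n : ℕ) [NeZero n] (d : ℕ) :
    IsClosed (AlgSpace.degLE k n d) := by
  set t := univTable k n
  have h : AlgSpace.degLE k n d = PrimeSpectrum.zeroLocus
      {r | ∃ s m, r = (genMinor (t.basis.repr 1)
        (fun j k => t.basis.repr (t.basis j * t.basis k)) d s).coeff m} := by
    ext x
    let e := t.baseChangeEquiv x.asIdeal.ResidueField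
    have h1 : x ∈ AlgSpace.degLE k n d ↔
        DegLE x.asIdeal.ResidueField (x.asIdeal.ResidueField ⊗[AlgRing k n] t.Carrier) d :=
      ⟨DegLE.of_algEquiv e.symm, DegLE.of_algEquiv e⟩
    rw [h1, degLE_iff_genMinor (t.basis.baseChange _)]
    simp only [genMinor_baseChange, MvPolynomial.ext_iff, MvPolynomial.coeff_map,
      MvPolynomial.coeff_zero, PrimeSpectrum.mem_zeroLocus, Ideal.algebraMap_residueField_eq_zero]
    constructor
    · rintro h _ ⟨s, m, rfl⟩
      exact h s m
    · exact fun h s m => h ⟨s, m, rfl⟩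
  rw [h]
  exact PrimeSpectrum.isClosed_zeroLocus _

theorem AlgStack.isClosed_degLE (k : Type u) [Field k] (n : ℕ) [NeZero n] (d : ℕ) :
    IsClosed (AlgStack.degLE k n d) := by
  rw [isClosed_coinduced]
  convert AlgSpace.isClosed_degLE k n d
  ext x
  exact AlgStack.pt_mem_degLE_iff (AlgStack.objAt x) d

/-! ### Separable algebras and lifting of homomorphisms. -/

section Separable

variable {R : Type u} [CommRing R]

/-- An algebra is separable if it has a separability element `∑ i, x i ⊗ y i`. -/
def IsSeparableAlgebra (R : Type u) [CommRing R] (A : Type v) [Ring A] [Algebra R A] : Prop :=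
  ∃ (ι : Type) (_ : Fintype ι) (x y : ι → A), ∑ i, x i * y i = 1 ∧
    ∀ a, ∑ i, (a * x i) ⊗ₜ[R] y i = ∑ i, x i ⊗ₜ[R] (y i * a)

/-- Homomorphisms from a separable algebra lift along square-zero extensions. -/
theorem IsSeparableAlgebra.exists_lift {A : Type v} [Ring A] [Algebra R A]
    [Module.Projective R A] (hA : IsSeparableAlgebra R A) {C D : Type*} [Ring C] [Algebra R C]
    [Ring D] [Algebra R D] (π : C →ₐ[R] D) (hπ : Function.Surjective π)
    (hsq : ∀ x y, π x = 0 → π y = 0 → x * y = 0) (f : A →ₐ[R] D) :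
    ∃ g : A →ₐ[R] C, π.comp g = f := by
  obtain ⟨ι, _, x, y, hxy, hsep⟩ := hA
  obtain ⟨s, hs⟩ := Module.projective_lifting_property π.toLinearMap f.toLinearMap hπ
  have hs (a : A) : π (s a) = f a := LinearMap.congr_fun hs a
  -- `F` measures the failure of the linear lift `s` to be multiplicative. It is a Hochschild
  -- 2-cocycle with values in the square-zero kernel of `π`.
  let F (a : A) : A →ₗ[R] C := LinearMap.mulLeft R (s a) ∘ₗ s - s ∘ₗ LinearMap.mulLeft R a
  have hF (a b : A) : F a b = s a * s b - s (a * b) := rfl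
  -- The separability element contracts the Hochschild complex: `h` is a cochain with coboundary
  -- `F`, so `s - h` is the corrected lift.
  let h : A →ₗ[R] C := ∑ i, LinearMap.mulLeft R (s (x i)) ∘ₗ F (y i)
  have hh (b : A) : h b = ∑ i, s (x i) * F (y i) b := by
    simp [h, LinearMap.sum_apply]
  have hFπ (a b : A) : π (F a b) = 0 := by simp [hF, hs]
  have hhπ (b : A) : π (h b) = 0 := by simp [hh, hFπ]
  -- Because the kernel has square zero, `s` acts multiplicatively on it and makes it a left
  -- `A`-module.
  have hsF (a b : A) (z : C) (hz : π z = 0) : s a * s b * z = s (a * b) * z := by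
    rw [← sub_eq_zero, ← sub_mul, ← hF]
    exact hsq _ _ (hFπ a b) hz
  have hs1 (z : C) (hz : π z = 0) : s 1 * z = z := by
    have := hsq (s 1 - 1) z (by simp [hs]) hz
    rwa [sub_mul, one_mul, sub_eq_zero] at this
  have hbal (a b : A) : ∑ i, s (a * x i) * F (y i) b = ∑ i, s (x i) * F (y i * a) b := by
    let Fb : A →ₗ[R] C := LinearMap.mulRight R (s b) ∘ₗ s - s ∘ₗ LinearMap.mulRight R b
    let β : A →ₗ[R] A →ₗ[R] C := (LinearMap.mul R C).compl₁₂ s Fb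
    have h1 := congrArg (TensorProduct.lift β) (hsep a)
    rw [map_sum, map_sum] at h1
    simp only [TensorProduct.lift.tmul] at h1
    have hβ (c d : A) : β c d = s c * F d b := rfl
    simpa only [hβ] using h1
  have hδ (a b : A) : s a * h b - h (a * b) + h a * s b = F a b := by
    have e1 : s a * h b = ∑ i, s (x i) * F (y i * a) b := by
      rw [← hbal, hh, Finset.mul_sum]
      exact Finset.sum_congr rfl fun i _ => by rw [← mul_assoc, hsF _ _ _ (hFπ _ _)]
    rw [e1, hh, hh, Finset.sum_mul, ← Finset.sum_sub_distrib, ← Finset.sum_add_distrib]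
    calc _ = ∑ i, s (x i * y i) * F a b := Finset.sum_congr rfl fun i _ => by
            rw [← hsF _ _ _ (hFπ a b)]
            simp only [hF, mul_assoc]
            noncomm_ring
      _ = F a b := by rw [← Finset.sum_mul, ← map_sum, hxy, hs1 _ (hFπ a b)]
  have hmul (a b : A) : (s - h) (a * b) = (s - h) a * (s - h) b := by
    have h0 := hsq _ _ (hhπ a) (hhπ b)
    have h1 := hδ a b
    rw [hF, eq_sub_iff_add_eq] at h1
    simp only [LinearMap.sub_apply, mul_sub, sub_mul, h0, ← h1]
    abel
  -- The element `e = (s - h) 1` is idempotent and `e - 1` lies in the kernel, so `0 = (e - 1)² = 1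
  -- - e`.
  have hone : (s - h) 1 = 1 := by
    have h0 : π ((s - h) 1 - 1) = 0 := by simp [hs, hhπ]
    have h1 := hsq _ _ h0 h0
    have h2 := hmul 1 1
    rw [mul_one] at h2
    rw [sub_mul, mul_sub, ← h2, mul_one, one_mul, sub_self, zero_sub, neg_eq_zero,
      sub_eq_zero] at h1
    exact h1
  refine ⟨AlgHom.ofLinearMap (s - h) hone hmul, AlgHom.ext fun a => ?_⟩
  simp [hs, hhπ]

end Separable

/-! ### The scheme of algebra homomorphisms and its smoothness. -/

theorem Module.Basis.map_mul_of_map_basis_mul {R A C : Type*} [CommRing R] [Ring A] [Algebra R A]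
    [Ring C] [Algebra R C] {ι : Type*} (b : Module.Basis ι R A) (f : A →ₗ[R] C)
    (h : ∀ i j, f (b i * b j) = f (b i) * f (b j)) (x y : A) : f (x * y) = f x * f y := by
  have h1 : (LinearMap.mul R A).compr₂ f = (LinearMap.mul R C).compl₁₂ f f :=
    b.ext fun i => b.ext fun j => h i j
  exact LinearMap.congr_fun (LinearMap.congr_fun h1 x) y

section HomRing

variable {R : Type u} [CommRing R] {A₀ A : Type u} [Ring A₀] [Algebra R A₀] [Ring A] [Algebra R A]
  {n : ℕ} (b₀ : Module.Basis (Fin n) R A₀) (b : Module.Basis (Fin n) R A)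

/-- The equations saying that the matrix of variables maps products of basis elements to
products. -/
noncomputable def homMulRel (q : Fin n × Fin n × Fin n) : MvPolynomial (Fin n × Fin n) R :=
  ∑ j, ∑ k, MvPolynomial.X (q.1, j) * MvPolynomial.X (q.2.1, k) *
      MvPolynomial.C (b.repr (b j * b k) q.2.2) -
    ∑ i, MvPolynomial.C (b₀.repr (b₀ q.1 * b₀ q.2.1) i) * MvPolynomial.X (i, q.2.2)

/-- The equations saying that the matrix of variables maps the unit to the unit. -/
noncomputable def homOneRel (l : Fin n) : MvPolynomial (Fin n × Fin n) R :=
  ∑ i, MvPolynomial.C (b₀.repr 1 i) * MvPolynomial.X (i, l) - MvPolynomial.C (b.repr 1 l)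

/-- The ideal of the scheme of algebra homomorphisms `A₀ → A` in the affine space of matrices. -/
noncomputable def homIdeal : Ideal (MvPolynomial (Fin n × Fin n) R) :=
  Ideal.span (Set.range (homMulRel b₀ b) ∪ Set.range (homOneRel b₀ b))

/-- The coordinate ring of the `R`-scheme of algebra homomorphisms `A₀ → A`. -/
abbrev HomRing : Type u := MvPolynomial (Fin n × Fin n) R ⧸ homIdeal b₀ b

namespace HomRing

/-- The coordinates on the scheme of algebra homomorphisms. -/
noncomputable def coord (q : Fin n × Fin n) : HomRing b₀ b :=
  Ideal.Quotient.mk (homIdeal b₀ b) (MvPolynomial.X q)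

instance finitePresentation : Algebra.FinitePresentation R (HomRing b₀ b) :=
  Algebra.FinitePresentation.quotient
    (Submodule.fg_span ((Set.finite_range _).union (Set.finite_range _)))

variable {b₀ b} {S : Type*} [CommRing S] [Algebra R S]

theorem hom_ext {ψ ψ' : HomRing b₀ b →ₐ[R] S}
    (h : ∀ q, ψ (coord b₀ b q) = ψ' (coord b₀ b q)) : ψ = ψ' :=
  Ideal.Quotient.algHom_ext _ (MvPolynomial.algHom_ext h)

/-- The linear map with a given matrix. -/
noncomputable def linearOfMatrix (b₀ : Module.Basis (Fin n) R A₀) (b : Module.Basis (Fin n) R A)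
    (y : Fin n × Fin n → S) : A₀ →ₗ[R] S ⊗[R] A :=
  b₀.constr R fun i => (b.baseChange S).equivFun.symm fun l => y (i, l)

theorem repr_linearOfMatrix (y : Fin n × Fin n → S) (a : A₀) (l : Fin n) :
    (b.baseChange S).repr (linearOfMatrix b₀ b y a) l =
      ∑ i, algebraMap R S (b₀.repr a i) * y (i, l) := by
  rw [linearOfMatrix, Module.Basis.constr_apply_fintype, map_sum, Finsupp.finsetSum_apply]
  refine Finset.sum_congr rfl fun i _ => ?_
  rw [← algebraMap_smul S, map_smul, Finsupp.smul_apply, smul_eq_mul]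
  congr 1
  exact congrFun ((b.baseChange S).equivFun.apply_symm_apply _) l

theorem repr_linearOfMatrix_basis (y : Fin n × Fin n → S) (i l : Fin n) :
    (b.baseChange S).repr (linearOfMatrix b₀ b y (b₀ i)) l = y (i, l) := by
  rw [repr_linearOfMatrix]
  simp [Finsupp.single_apply]

theorem repr_baseChange_mul (x y : S ⊗[R] A) (l : Fin n) :
    (b.baseChange S).repr (x * y) l = ∑ j, ∑ k, (b.baseChange S).repr x j *
      (b.baseChange S).repr y k * algebraMap R S (b.repr (b j * b k) l) := by
  rw [(b.baseChange S).repr_mul_eq_sum]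
  simp only [Module.Basis.baseChange_apply, Algebra.TensorProduct.tmul_mul_tmul, one_mul,
    Module.Basis.baseChange_repr_one_tmul]

theorem aeval_homMulRel_eq_zero_iff (y : Fin n × Fin n → S) (i j l : Fin n) :
    MvPolynomial.aeval y (homMulRel b₀ b (i, j, l)) = 0 ↔
      (b.baseChange S).repr (linearOfMatrix b₀ b y (b₀ i) * linearOfMatrix b₀ b y (b₀ j)) l =
        (b.baseChange S).repr (linearOfMatrix b₀ b y (b₀ i * b₀ j)) l := by
  rw [repr_baseChange_mul, repr_linearOfMatrix y (b₀ i * b₀ j)]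
  conv_rhs => rw [← sub_eq_zero]
  simp only [repr_linearOfMatrix_basis, homMulRel, map_sub, map_sum, map_mul, MvPolynomial.aeval_X,
    MvPolynomial.aeval_C]

theorem aeval_homOneRel_eq_zero_iff (y : Fin n × Fin n → S) (l : Fin n) :
    MvPolynomial.aeval y (homOneRel b₀ b l) = 0 ↔
      (b.baseChange S).repr (linearOfMatrix b₀ b y 1) l = (b.baseChange S).repr 1 l := by
  rw [repr_linearOfMatrix, Algebra.TensorProduct.one_def, Module.Basis.baseChange_repr_one_tmul]
  conv_rhs => rw [← sub_eq_zero]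
  simp only [homOneRel, map_sub, map_sum, map_mul, MvPolynomial.aeval_X, MvPolynomial.aeval_C]

theorem aeval_coord_eq_zero (ψ : HomRing b₀ b →ₐ[R] S) {p : MvPolynomial (Fin n × Fin n) R}
    (hp : p ∈ homIdeal b₀ b) : MvPolynomial.aeval (fun q => ψ (coord b₀ b q)) p = 0 := by
  have h1 : MvPolynomial.aeval (fun q => ψ (coord b₀ b q)) =
      ψ.comp (Ideal.Quotient.mkₐ R (homIdeal b₀ b)) :=
    MvPolynomial.algHom_ext fun q => by simp [coord]
  rw [h1, AlgHom.comp_apply, Ideal.Quotient.mkₐ_eq_mk, Ideal.Quotient.eq_zero_iff_mem.mpr hp,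
    map_zero]

/-- A point of the scheme of homomorphisms gives an algebra homomorphism. -/
theorem exists_algHom (ψ : HomRing b₀ b →ₐ[R] S) :
    ∃ f : A₀ →ₐ[R] S ⊗[R] A,
      ∀ i l, (b.baseChange S).repr (f (b₀ i)) l = ψ (coord b₀ b (i, l)) :=
  ⟨AlgHom.ofLinearMap (linearOfMatrix b₀ b fun q => ψ (coord b₀ b q))
    ((b.baseChange S).ext_elem fun l => (aeval_homOneRel_eq_zero_iff _ l).mp
      (aeval_coord_eq_zero ψ (Ideal.subset_span (Or.inr ⟨l, rfl⟩))))
    (b₀.map_mul_of_map_basis_mul _ fun i j => (b.baseChange S).ext_elem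
      fun l => ((aeval_homMulRel_eq_zero_iff _ i j l).mp
        (aeval_coord_eq_zero ψ (Ideal.subset_span (Or.inl ⟨(i, j, l), rfl⟩)))).symm),
    fun i l => by
      rw [AlgHom.ofLinearMap_apply, repr_linearOfMatrix_basis]⟩

theorem exists_repr_eq (f : A₀ →ₐ[R] S ⊗[R] A) :
    ∃ ψ : HomRing b₀ b →ₐ[R] S,
      ∀ i l, ψ (coord b₀ b (i, l)) = (b.baseChange S).repr (f (b₀ i)) l := by
  set y : Fin n × Fin n → S := fun q => (b.baseChange S).repr (f (b₀ q.1)) q.2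
  have hy : linearOfMatrix b₀ b y = f.toLinearMap := b₀.ext fun i =>
    (b.baseChange S).ext_elem fun l => repr_linearOfMatrix_basis y i l
  have hy (a : A₀) : linearOfMatrix b₀ b y a = f a := LinearMap.congr_fun hy a
  have h : homIdeal b₀ b ≤ RingHom.ker (MvPolynomial.aeval (R := R) y) := by
    rw [homIdeal, Ideal.span_le]
    rintro _ (⟨⟨i, j, l⟩, rfl⟩ | ⟨l, rfl⟩)
    · exact (aeval_homMulRel_eq_zero_iff y i j l).mpr (by simp only [hy, map_mul])
    · exact (aeval_homOneRel_eq_zero_iff y l).mpr (by simp only [hy, map_one])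
  refine ⟨Ideal.Quotient.liftₐ _ (MvPolynomial.aeval y) fun a ha => h ha, fun i l => ?_⟩
  exact MvPolynomial.aeval_X y (i, l)

theorem repr_map {S' : Type*} [CommRing S'] [Algebra R S'] (φ : S →ₐ[R] S') (z : S ⊗[R] A)
    (l : Fin n) :
    (b.baseChange S').repr (Algebra.TensorProduct.map φ (AlgHom.id R A) z) l =
      φ ((b.baseChange S).repr z l) := by
  induction z with
  | zero => simp
  | tmul s a => simp
  | add x y hx hy => simp [hx, hy]

/-- This is the infinitesimal criterion. `S`-points are homomorphisms `A₀ → S ⊗ A`, so lifting a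
point from `B ⧸ I` to `B` with `I² = 0` is lifting a homomorphism along `B ⊗ A → (B ⧸ I) ⊗ A`. -/
theorem smooth (b₀ : Module.Basis (Fin n) R A₀) (b : Module.Basis (Fin n) R A)
    (hA₀ : IsSeparableAlgebra R A₀) : Algebra.Smooth R (HomRing b₀ b) := by
  have := Module.Free.of_basis b₀
  refine ⟨Algebra.FormallySmooth.of_comp_surjective fun B _ _ I hI φ => ?_, inferInstance⟩
  let π : B ⊗[R] A →ₐ[R] (B ⧸ I) ⊗[R] A :=
    Algebra.TensorProduct.map (Ideal.Quotient.mkₐ R I) (AlgHom.id R A)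
  have hπ : Function.Surjective π :=
    TensorProduct.map_surjective Ideal.Quotient.mk_surjective Function.surjective_id
  -- Elements of the kernel of `π` have coordinates in `I`, so products of two have coordinates in
  -- `I² = 0`.
  have hmem (x) (hx : π x = 0) (l) : (b.baseChange B).repr x l ∈ I := by
    have h1 := repr_map (b := b) (Ideal.Quotient.mkₐ R I) x l
    rw [show Algebra.TensorProduct.map (Ideal.Quotient.mkₐ R I) (AlgHom.id R A) x = 0 from hx,
      map_zero, Finsupp.zero_apply, Ideal.Quotient.mkₐ_eq_mk] at h1
    exact Ideal.Quotient.eq_zero_iff_mem.mp h1.symm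
  obtain ⟨f, hf⟩ := exists_algHom φ
  obtain ⟨g, hg⟩ := hA₀.exists_lift π hπ (fun x y hx hy => (b.baseChange B).ext_elem fun l => by
    rw [repr_baseChange_mul, map_zero, Finsupp.zero_apply]
    refine Finset.sum_eq_zero fun j _ => Finset.sum_eq_zero fun k _ => ?_
    have h1 := Ideal.mul_mem_mul (hmem x hx j) (hmem y hy k)
    rw [← pow_two, hI, Ideal.mem_bot] at h1
    rw [h1, zero_mul]) f
  obtain ⟨ψ, hψ⟩ := exists_repr_eq (b₀ := b₀) (b := b) g
  refine ⟨ψ, hom_ext fun ⟨i, l⟩ => ?_⟩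
  rw [AlgHom.comp_apply, hψ, ← repr_map, ← hf, ← hg]
  rfl

end HomRing

end HomRing

/-! ### Products of matrix algebras: separability and base change. -/

section MatrixAlgebras

/-- The element `∑ j, E_{j0} ⊗ E_{0j}` works over every ring, with no division by `N`; `1 ≤ N`
supplies the index `0`. -/
theorem IsSeparableAlgebra.matrix (R : Type u) [CommRing R] {N : ℕ} (hN : 1 ≤ N) :
    IsSeparableAlgebra R (Matrix (Fin N) (Fin N) R) := by
  let z : Fin N := ⟨0, hN⟩
  refine ⟨Fin N, inferInstance, fun j => Matrix.single j z 1, fun j => Matrix.single z j 1, ?_,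
    fun a => ?_⟩
  · simp only [Matrix.single_mul_single_same, mul_one]
    exact Matrix.sum_single_one
  · have h1 (j : Fin N) : a * Matrix.single j z 1 = ∑ p, a p j • Matrix.single p z (1 : R) := by
      ext p q
      simp [Matrix.sum_apply, Matrix.mul_apply, Matrix.single_apply, ite_and]
    have h2 (j : Fin N) : Matrix.single z j 1 * a = ∑ p, a j p • Matrix.single z p (1 : R) := by
      ext p q
      simp [Matrix.sum_apply, Matrix.mul_apply, Matrix.single_apply, ite_and]
    simp only [h1, h2, TensorProduct.sum_tmul, TensorProduct.tmul_sum, TensorProduct.smul_tmul]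
    exact Finset.sum_comm

theorem IsSeparableAlgebra.pi {R : Type u} [CommRing R] {r : ℕ} {A : Fin r → Type v}
    [∀ i, Ring (A i)] [∀ i, Algebra R (A i)] (h : ∀ i, IsSeparableAlgebra R (A i)) :
    IsSeparableAlgebra R (∀ i, A i) := by
  choose ι hι x y hxy hsep using h
  refine ⟨Σ i, ι i, inferInstance, fun p => Pi.single p.1 (x p.1 p.2),
    fun p => Pi.single p.1 (y p.1 p.2), ?_, fun a => ?_⟩
  · simp only [← Pi.single_mul, Fintype.sum_sigma]
    have h (i : Fin r) : ∑ j, (Pi.single i (x i j * y i j) : ∀ i, A i) = Pi.single i 1 := by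
      rw [← hxy i]
      exact (map_sum (AddMonoidHom.single A i) _ _).symm
    simp only [h]
    exact Finset.univ_sum_single (1 : ∀ i, A i)
  · simp only [Fintype.sum_sigma]
    refine Finset.sum_congr rfl fun i _ => ?_
    have h := congrArg (TensorProduct.map (LinearMap.single R A i) (LinearMap.single R A i))
      (hsep i (a i))
    simp only [map_sum, TensorProduct.map_tmul, LinearMap.coe_single] at h
    simpa only [Pi.single_mul_left, Pi.single_mul_right] using h

/-- The split semisimple algebra `M_{m_1}(R) × ⋯ × M_{m_r}(R)`. -/
abbrev MatrixProduct {r : ℕ} (m : Fin r → ℕ) (R : Type u) : Type u :=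
  ∀ i : Fin r, Matrix (Fin (m i)) (Fin (m i)) R

namespace MatrixProduct

variable {r : ℕ} (m : Fin r → ℕ)

theorem isSeparableAlgebra (hm : ∀ i, 1 ≤ m i) (R : Type u) [CommRing R] :
    IsSeparableAlgebra R (MatrixProduct m R) :=
  IsSeparableAlgebra.pi fun i => IsSeparableAlgebra.matrix R (hm i)

/-- A basis of a product of matrix algebras. -/
noncomputable def basis (R : Type u) [CommRing R] {n : ℕ} (hn : n = ∑ i, m i ^ 2) :
    Module.Basis (Fin n) R (MatrixProduct m R) :=
  (Pi.basis fun i => Matrix.stdBasis R (Fin (m i)) (Fin (m i))).reindex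
    (Fintype.equivFinOfCardEq (by simp [hn, sq]))

/-- Matrices commute with base change. -/
noncomputable def _root_.Matrix.baseChangeEquiv (N : ℕ) (R : Type u) (S : Type v) [CommRing R]
    [CommRing S] [Algebra R S] :
    S ⊗[R] Matrix (Fin N) (Fin N) R ≃ₐ[S] Matrix (Fin N) (Fin N) S :=
  AlgEquiv.ofRingEquiv (f := (matrixEquivTensor (Fin N) R S).symm.toRingEquiv) fun s => by
    have h := matrixEquivTensor_apply_symm (n := Fin N) (R := R) (A := S) s 1
    rw [Matrix.map_one _ (map_zero _) (map_one _)] at h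
    exact h.trans (Algebra.algebraMap_eq_smul_one s).symm

/-- Products of matrix algebras commute with base change. -/
noncomputable def baseChangeEquiv (R : Type u) (S : Type v) [CommRing R] [CommRing S]
    [Algebra R S] : S ⊗[R] MatrixProduct m R ≃ₐ[S] MatrixProduct m S :=
  (Algebra.TensorProduct.piRight R S S _).trans
    (AlgEquiv.piCongrRight fun i => Matrix.baseChangeEquiv (m i) R S)

end MatrixProduct

end MatrixAlgebras

/-! ### Degree bound from Cayley–Hamilton. -/

section Degree

theorem exteriorPower.ιMulti_eq_zero_of_last {S : Type u} [CommRing S] {M : Type v}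
    [AddCommGroup M] [Module S M] {d : ℕ} (v : ℕ → M) (c : ℕ → S)
    (h : v d = ∑ i ∈ Finset.range d, c i • v i) :
    exteriorPower.ιMulti S (d + 1) (fun i : Fin (d + 1) => v i) = 0 := by
  have h1 : (fun i : Fin (d + 1) => v i) = Function.update (fun i : Fin (d + 1) => v i)
      (Fin.last d) (∑ i ∈ Finset.range d, c i • v i) := by
    rw [← h]
    exact (Function.update_eq_self (Fin.last d) fun i : Fin (d + 1) => v i).symm
  rw [h1, AlternatingMap.map_update_sum]
  refine Finset.sum_eq_zero fun i hi => ?_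
  have hi := Finset.mem_range.mp hi
  rw [AlternatingMap.map_update_smul]
  have h2 := (exteriorPower.ιMulti S (d + 1) (M := M)).map_update_self
    (fun i : Fin (d + 1) => v i) (i := Fin.last d) (j := ⟨i, by omega⟩)
    (by simp [Fin.ext_iff]; omega)
  rw [h2, smul_zero]

theorem ιMulti_pow_eq_zero_of_monic {S : Type u} [CommRing S] {B : Type v} [Ring B] [Algebra S B]
    {d : ℕ} (a : B) (p : Polynomial S) (hp : p.Monic) (hd : p.natDegree ≤ d)
    (ha : Polynomial.aeval a p = 0) :
    exteriorPower.ιMulti S (d + 1) (fun i : Fin (d + 1) => a ^ (i : ℕ)) = 0 := by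
  rcases subsingleton_or_nontrivial S with hS | hS
  · have := Module.subsingleton S (⋀[S]^(d + 1) B)
    exact Subsingleton.elim _ _
  -- Padding by a power of `X` makes the degree exactly `d`, so that `a ^ d` is a combination of
  -- lower powers.
  set q := Polynomial.X ^ (d - p.natDegree) * p
  have hq : q.Monic := (Polynomial.monic_X_pow _).mul hp
  have hqd : q.natDegree = d := by
    rw [(Polynomial.monic_X_pow _).natDegree_mul hp, Polynomial.natDegree_X_pow]
    omega
  have hqa : Polynomial.aeval a q = 0 := by rw [map_mul, ha, mul_zero]
  refine exteriorPower.ιMulti_eq_zero_of_last (fun i => a ^ i) (fun i => -q.coeff i) ?_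
  rw [Polynomial.aeval_eq_sum_range, hqd, Finset.sum_range_succ] at hqa
  have hc : q.coeff d = 1 := by rw [← hqd]; exact hq
  rw [hc, one_smul] at hqa
  simp only [neg_smul, Finset.sum_neg_distrib]
  exact eq_neg_of_add_eq_zero_right hqa

theorem MatrixProduct.degLE {r : ℕ} (m : Fin r → ℕ) (R : Type u) [CommRing R] {d : ℕ}
    (hd : ∑ i, m i ≤ d) : DegLE R (MatrixProduct m R) d := by
  intro S _ _ a
  rcases subsingleton_or_nontrivial S with hS | hS
  · have := Module.subsingleton S (⋀[S]^(d + 1) (S ⊗[R] MatrixProduct m R))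
    exact Subsingleton.elim _ _
  let e := MatrixProduct.baseChangeEquiv m R S
  let p : Polynomial S := ∏ i, (e a i).charpoly
  refine ιMulti_pow_eq_zero_of_monic a p (Polynomial.monic_prod_of_monic _ _
    fun i _ => Matrix.charpoly_monic _) ?_ (e.injective ?_)
  · rw [Polynomial.natDegree_prod_of_monic _ _ fun i _ => Matrix.charpoly_monic _]
    simpa [Matrix.charpoly_natDegree_eq_dim] using hd
  · rw [map_zero, ← Polynomial.aeval_algHom_apply]
    funext i
    have h1 : Polynomial.aeval (e a) p i = Polynomial.aeval (e a i) p :=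
      (Polynomial.aeval_algHom_apply (Pi.evalAlgHom S (fun i => Matrix (Fin (m i)) (Fin (m i)) S) i) (e a) p).symm
    have h2 : (e a i).charpoly ∣ p := Finset.dvd_prod_of_mem _ (Finset.mem_univ i)
    obtain ⟨q, hq⟩ := h2
    exact h1.trans (by rw [hq, map_mul, Matrix.aeval_self_charpoly, zero_mul]; rfl)

end Degree

/-! ### Openness of the isomorphism locus. -/

section IsomLocus

variable {R : Type u} [CommRing R] {A₀ A : Type u} [Ring A₀] [Algebra R A₀] [Ring A] [Algebra R A]
  {n : ℕ}

open HomRing in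
/-- The locus where an algebra is geometrically isomorphic to a separable algebra is open. -/
theorem isOpen_isomLocus (b₀ : Module.Basis (Fin n) R A₀) (b : Module.Basis (Fin n) R A)
    (hA₀ : IsSeparableAlgebra R A₀) :
    IsOpen {x : PrimeSpectrum R | ∃ (L : Type u) (_ : Field L) (_ : Algebra R L),
      RingHom.ker (algebraMap R L) = x.asIdeal ∧ Nonempty (L ⊗[R] A₀ ≃ₐ[L] L ⊗[R] A)} := by
  have := HomRing.smooth b₀ b hA₀
  let T := HomRing b₀ b
  -- The determinant of the universal homomorphism; its basic open set is the scheme of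
  -- isomorphisms.
  let Δ : T := (Matrix.of fun l i => coord b₀ b (i, l)).det
  have hΔ (L : Type u) [Field L] [Algebra R L] (ψ : T →ₐ[R] L) (F : L ⊗[R] A₀ →ₐ[L] L ⊗[R] A)
      (hF : ∀ i l, (b.baseChange L).repr (F (1 ⊗ₜ b₀ i)) l = ψ (coord b₀ b (i, l))) :
      (LinearMap.toMatrix (b₀.baseChange L) (b.baseChange L) F.toLinearMap).det = ψ Δ := by
    rw [AlgHom.map_det]
    congr 1
    ext l i
    rw [LinearMap.toMatrix_apply, Module.Basis.baseChange_apply]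
    exact hF i l
  -- A smooth algebra is flat, hence has going down, and is finitely presented, so the map on
  -- spectra is open.
  convert (PrimeSpectrum.isOpenMap_comap_of_hasGoingDown_of_finitePresentation
    (R := R) (S := T)) _ (PrimeSpectrum.isOpen_basicOpen (a := Δ)) using 1
  ext x
  constructor
  · rintro ⟨L, _, _, hL, ⟨e⟩⟩
    obtain ⟨ψ, hψ⟩ := exists_repr_eq (b₀ := b₀) (b := b)
      (((e : L ⊗[R] A₀ →ₐ[L] L ⊗[R] A).restrictScalars R).comp Algebra.TensorProduct.includeRight)
    refine ⟨⟨RingHom.ker ψ, RingHom.ker_isPrime _⟩, ?_, ?_⟩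
    · have h1 := hΔ L ψ e fun i l => (hψ i l).symm
      have h2 := LinearEquiv.isUnit_det e.toLinearEquiv (b₀.baseChange L) (b.baseChange L)
      intro h3
      exact h2.ne_zero (h1.trans h3)
    · ext1
      rw [← hL, PrimeSpectrum.comap_asIdeal, ← ψ.comp_algebraMap]
      rfl
  · rintro ⟨q, hq, rfl⟩
    -- The universal homomorphism specialised to the residue field at `q` is invertible because `Δ`
    -- does not vanish there.
    let L := q.asIdeal.ResidueField
    obtain ⟨f, hf⟩ := exists_algHom (IsScalarTower.toAlgHom R T L)
    let F : L ⊗[R] A₀ →ₐ[L] L ⊗[R] A := AlgHom.liftEquiv R L A₀ (L ⊗[R] A) f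
    have h1 := hΔ L (IsScalarTower.toAlgHom R T L) F fun i l => by
      rw [← hf]
      simp [F]
    have h2 : IsUnit (LinearMap.toMatrix (b₀.baseChange L) (b.baseChange L) F.toLinearMap).det := by
      rw [h1, isUnit_iff_ne_zero]
      exact fun h => hq (Ideal.algebraMap_residueField_eq_zero.mp h)
    refine ⟨L, inferInstance, inferInstance, ?_, ⟨AlgEquiv.ofBijective F
      (LinearEquiv.ofIsUnitDet h2).bijective⟩⟩
    rw [IsScalarTower.algebraMap_eq R T L, ← RingHom.comap_ker, Ideal.ker_algebraMap_residueField]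
    rfl

end IsomLocus

/-! ### Forms of the split algebra as a point of the stack. -/

section Split

/-- Base change is transitive, for noncommutative algebras. -/
noncomputable def cancelBaseChangeAlgEquiv (R S E A : Type u) [CommRing R] [CommRing S]
    [CommRing E] [Ring A] [Algebra R S] [Algebra R E] [Algebra S E] [IsScalarTower R S E]
    [Algebra R A] : E ⊗[S] (S ⊗[R] A) ≃ₐ[E] E ⊗[R] A :=
  AlgEquiv.symm <| Algebra.TensorProduct.algEquivOfLinearEquivTensorProduct
    (TensorProduct.AlgebraTensorModule.cancelBaseChange R S E E A).symm
    (fun _ _ _ _ => by simp) (by simp [Algebra.TensorProduct.one_def])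

/-- Two extensions of a field are contained in a common one. -/
theorem exists_common_extension (K L₁ L₂ : Type u) [Field K] [Field L₁] [Field L₂] [Algebra K L₁]
    [Algebra K L₂] :
    ∃ (E : Type u) (_ : Field E) (_ : Algebra K E) (_ : Algebra L₁ E) (_ : Algebra L₂ E),
      IsScalarTower K L₁ E ∧ IsScalarTower K L₂ E := by
  obtain ⟨I, hI⟩ := Ideal.exists_maximal (L₁ ⊗[K] L₂)
  let E := (L₁ ⊗[K] L₂) ⧸ I
  let _ : Field E := Ideal.Quotient.field I
  let f : L₂ →ₐ[K] E := (Ideal.Quotient.mkₐ K I).comp Algebra.TensorProduct.includeRight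
  let _ : Algebra L₂ E := f.toRingHom.toAlgebra
  exact ⟨E, inferInstance, inferInstance, inferInstance, inferInstance, inferInstance,
    IsScalarTower.of_algebraMap_eq fun x => (f.commutes x).symm⟩

/-- An algebra over a field which becomes a product of matrix algebras over an extension. -/
def IsGeomSplit {r : ℕ} (m : Fin r → ℕ) (K A : Type u) [Field K] [Ring A] [Algebra K A] : Prop :=
  ∃ (L : Type u) (_ : Field L) (_ : Algebra K L), Nonempty (L ⊗[K] A ≃ₐ[L] MatrixProduct m L)

variable {r : ℕ} {m : Fin r → ℕ}

theorem IsGeomSplit.matrixProduct (K : Type u) [Field K] :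
    IsGeomSplit m K (MatrixProduct m K) :=
  ⟨K, inferInstance, inferInstance, ⟨MatrixProduct.baseChangeEquiv m K K⟩⟩

theorem IsGeomSplit.of_baseChange {K A L : Type u} [Field K] [Ring A] [Algebra K A] [Field L]
    [Algebra K L] (h : IsGeomSplit m L (L ⊗[K] A)) : IsGeomSplit m K A := by
  obtain ⟨E, _, _, ⟨e⟩⟩ := h
  let _ : Algebra K E := ((algebraMap L E).comp (algebraMap K L)).toAlgebra
  have : IsScalarTower K L E := IsScalarTower.of_algebraMap_eq fun _ => rfl
  exact ⟨E, inferInstance, inferInstance,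
    ⟨(cancelBaseChangeAlgEquiv K L E A).symm.trans e⟩⟩

theorem IsGeomSplit.baseChange {K A : Type u} [Field K] [Ring A] [Algebra K A]
    (h : IsGeomSplit m K A) (L : Type u) [Field L] [Algebra K L] :
    IsGeomSplit m L (L ⊗[K] A) := by
  obtain ⟨L', _, _, ⟨e⟩⟩ := h
  obtain ⟨E, _, _, _, _, _, _⟩ := exists_common_extension K L L'
  refine ⟨E, inferInstance, inferInstance, ⟨?_⟩⟩
  exact (cancelBaseChangeAlgEquiv K L E A).trans <|
    (cancelBaseChangeAlgEquiv K L' E A).symm.trans <|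
    (Algebra.TensorProduct.congr AlgEquiv.refl e).trans <| MatrixProduct.baseChangeEquiv m L' E

theorem IsGeomSplit.of_algEquiv {K A B : Type u} [Field K] [Ring A] [Algebra K A] [Ring B]
    [Algebra K B] (h : IsGeomSplit m K A) (e : A ≃ₐ[K] B) : IsGeomSplit m K B := by
  obtain ⟨L, _, _, ⟨f⟩⟩ := h
  exact ⟨L, inferInstance, inferInstance,
    ⟨(Algebra.TensorProduct.congr AlgEquiv.refl e.symm).trans f⟩⟩

theorem AlgObj.SamePoint.isGeomSplit_iff {k : Type u} [Field k] {n : ℕ} {P Q : AlgObj k n}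
    (h : P.SamePoint Q) : IsGeomSplit m P.K P.A ↔ IsGeomSplit m Q.K Q.A := by
  obtain ⟨L, _, _, _, -, ⟨e⟩⟩ := h
  exact ⟨fun h => ((h.baseChange L).of_algEquiv e).of_baseChange,
    fun h => ((h.baseChange L).of_algEquiv e.symm).of_baseChange⟩

theorem AlgStack.isGeomSplit_iff_of_pt_eq {k : Type u} [Field k] {n : ℕ} {P Q : AlgObj k n}
    (h : AlgStack.pt P = AlgStack.pt Q) : IsGeomSplit m P.K P.A ↔ IsGeomSplit m Q.K Q.A := by
  have h1 : Relation.EqvGen AlgObj.SamePoint P Q := Quot.eqvGen_exact h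
  clear h
  induction h1 with
  | rel _ _ h => exact h.isGeomSplit_iff
  | refl => rfl
  | symm _ _ _ ih => exact ih.symm
  | trans _ _ _ _ _ ih1 ih2 => exact ih1.trans ih2

/-- Being a form of the split algebra is invariant under `SamePoint`. Conversely, the split algebra
is defined over `k`, so an extension of `P.K` that splits `P.A` already serves as a common
extension. -/
theorem AlgStack.pt_eq_matrixProductObj_iff {k : Type u} [Field k] {n : ℕ}
    (hn : n = ∑ i, m i ^ 2) (P : AlgObj k n) :
    AlgStack.pt P = AlgStack.pt (matrixProductObj k m hn) ↔ IsGeomSplit m P.K P.A := by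
  constructor
  · intro h
    exact (AlgStack.isGeomSplit_iff_of_pt_eq h).mpr (IsGeomSplit.matrixProduct k)
  · rintro ⟨L, _, _, ⟨e⟩⟩
    let _ : Algebra k L := ((algebraMap P.K L).comp (algebraMap k P.K)).toAlgebra
    refine Quot.sound ⟨L, inferInstance, inferInstance, (inferInstance : Algebra k L), rfl, ⟨?_⟩⟩
    have f : L ⊗[P.K] P.A ≃ₐ[L] L ⊗[k] MatrixProduct m k :=
      e.trans (MatrixProduct.baseChangeEquiv m k L).symm
    exact f

end Split

/-! ### Openness of the point and conclusion. -/

section Main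

variable {k : Type u} [Field k] {r : ℕ} {m : Fin r → ℕ} {n : ℕ} [NeZero n]

theorem isGeomSplit_objAt_iff (x : AlgSpace k n) :
    IsGeomSplit m (AlgStack.objAt x).K (AlgStack.objAt x).A ↔
      ∃ (L : Type u) (_ : Field L) (_ : Algebra (AlgRing k n) L),
        RingHom.ker (algebraMap (AlgRing k n) L) = x.asIdeal ∧
        Nonempty (L ⊗[AlgRing k n] MatrixProduct m (AlgRing k n) ≃ₐ[L]
          L ⊗[AlgRing k n] (univTable k n).Carrier) := by
  let R := AlgRing k n
  let A := (univTable k n).Carrier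
  let κ := x.asIdeal.ResidueField
  let e : κ ⊗[R] A ≃ₐ[κ] (tableAt k n x).Carrier := (univTable k n).baseChangeEquiv κ
  have hiff : IsGeomSplit m κ (tableAt k n x).Carrier ↔ IsGeomSplit m κ (κ ⊗[R] A) :=
    ⟨fun h => h.of_algEquiv e.symm, fun h => h.of_algEquiv e⟩
  refine hiff.trans ?_
  constructor
  · rintro ⟨L, _, _, ⟨f⟩⟩
    let _ : Algebra R L := ((algebraMap κ L).comp (algebraMap R κ)).toAlgebra
    have : IsScalarTower R κ L := IsScalarTower.of_algebraMap_eq fun _ => rfl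
    refine ⟨L, inferInstance, inferInstance, ?_, ⟨?_⟩⟩
    · rw [IsScalarTower.algebraMap_eq R κ L, ← RingHom.comap_ker,
        (RingHom.injective_iff_ker_eq_bot _).mp (algebraMap κ L).injective]
      exact Ideal.ker_algebraMap_residueField x.asIdeal
    · exact (MatrixProduct.baseChangeEquiv m R L).trans <| f.symm.trans <|
        cancelBaseChangeAlgEquiv R κ L A
  · rintro ⟨L, _, _, hL, ⟨f⟩⟩
    -- A map to a field with kernel exactly the prime of `x` factors through the residue field at
    -- `x`.
    let φ : κ →+* L := Ideal.ResidueField.lift x.asIdeal (algebraMap R L) hL.ge fun a ha =>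
      isUnit_iff_ne_zero.mpr fun h => ha (hL.le h)
    let _ : Algebra κ L := φ.toAlgebra
    have : IsScalarTower R κ L := IsScalarTower.of_algebraMap_eq fun a =>
      (Ideal.ResidueField.lift_algebraMap _ _ _ _ a).symm
    exact ⟨L, inferInstance, inferInstance,
      ⟨(cancelBaseChangeAlgEquiv R κ L A).trans <| f.symm.trans <|
        MatrixProduct.baseChangeEquiv m R L⟩⟩

theorem AlgStack.isOpen_singleton_matrixProductObj (hm : ∀ i, 1 ≤ m i) (hn : n = ∑ i, m i ^ 2) :
    IsOpen {AlgStack.pt (matrixProductObj k m hn)} := by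
  rw [isOpen_coinduced]
  convert isOpen_isomLocus (MatrixProduct.basis m (AlgRing k n) hn) (univTable k n).basis
    (MatrixProduct.isSeparableAlgebra m hm (AlgRing k n)) using 1
  ext x
  exact (AlgStack.pt_eq_matrixProductObj_iff hn (AlgStack.objAt x)).trans
    (isGeomSplit_objAt_iff x)

/-- A nonempty open part of an irreducible set is dense in it. -/
theorem subset_of_isPreirreducible_of_isOpen {X : Type*} [TopologicalSpace X] {Z U F : Set X}
    (hZ : IsPreirreducible Z) (hU : IsOpen U) (hF : IsClosed F) (hUF : U ⊆ F)
    (h : (Z ∩ U).Nonempty) : Z ⊆ F :=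
  (subset_closure_inter_of_isPreirreducible_of_isOpen hZ hU h).trans
    (hF.closure_subset_iff.mpr (Set.inter_subset_right.trans hUF))

theorem sum_le_sum_sq_sub_of_isLeast (hm2 : ∃ i, 2 ≤ m i) {ν : ℕ}
    (hν : IsLeast (Set.range m) ν) : ∑ i, m i ≤ ∑ i, m i ^ 2 - ν := by
  obtain ⟨j, hj⟩ := hm2
  have h1 : ν ≤ m j := hν.2 ⟨j, rfl⟩
  -- Each `m i ≤ m i ^ 2`, and at `j` even `2 * m j ≤ m j ^ 2`; the surplus `m j` is at least `ν`.
  have h2 : ∑ i, (m i + if i = j then m j else 0) ≤ ∑ i, m i ^ 2 := by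
    refine Finset.sum_le_sum fun i _ => ?_
    split_ifs with h
    · subst h
      nlinarith
    · simpa using Nat.le_self_pow two_ne_zero (m i)
  rw [Finset.sum_add_distrib, Finset.sum_ite_eq' Finset.univ j, if_pos (Finset.mem_univ j)] at h2
  omega

end Main

theorem proposition4p4 (k : Type u) [Field k] (r : ℕ) (m : Fin r → ℕ) (hm : ∀ i, 1 ≤ m i)
    (hm2 : ∃ i, 2 ≤ m i) (n : ℕ) [NeZero n] (hn : n = ∑ i, m i ^ 2)
    (ν : ℕ) (hν : IsLeast (Set.range m) ν) :
    (∀ Z ∈ irreducibleComponents (AlgStack k n),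
      AlgStack.pt (matrixProductObj k m hn) ∈ Z → Z ⊆ AlgStack.degLE k n (n - ν)) ∧
    (∀ Z ∈ irreducibleComponents (AlgSpace k n), ∀ x ∈ Z,
      AlgStack.proj x = AlgStack.pt (matrixProductObj k m hn) →
        Z ⊆ AlgSpace.degLE k n (n - ν)) := by
  have hopen := AlgStack.isOpen_singleton_matrixProductObj (k := k) hm hn
  have hd : ∑ i, m i ≤ n - ν := by
    rw [hn]
    exact sum_le_sum_sq_sub_of_isLeast hm2 hν
  have hmem : AlgStack.pt (matrixProductObj k m hn) ∈ AlgStack.degLE k n (n - ν) :=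
    ⟨_, MatrixProduct.degLE m k hd, rfl⟩
  refine ⟨fun Z hZ h => ?_, fun Z hZ x hx h => ?_⟩
  · exact subset_of_isPreirreducible_of_isOpen hZ.1.isPreirreducible hopen
      (AlgStack.isClosed_degLE k n _) (Set.singleton_subset_iff.mpr hmem) ⟨_, h, rfl⟩
  · refine subset_of_isPreirreducible_of_isOpen hZ.1.isPreirreducible (isOpen_coinduced.mp hopen)
      (AlgSpace.isClosed_degLE k n _) (fun y hy => ?_) ⟨x, hx, h⟩
    have hy : AlgStack.proj y = AlgStack.pt (matrixProductObj k m hn) := hy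
    exact (AlgStack.pt_mem_degLE_iff (AlgStack.objAt y) _).mp (hy.symm ▸ hmem : AlgStack.proj y ∈ _)
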